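/- Let $m$ be the normalized Lebesgue measure on the unit circle $\mathbb T$, and write $(\cdot,\cdot)$ for the scalar product of $L^2(\mathbb T,m)$, linear in the first argument. Let $H^2$ be the Hardy space, regarded through boundary values as the subspace of $L^2(\mathbb T,m)$ of functions whose Fourier coefficients of negative index vanish; for $f\in H^2$, $f(0)$ denotes the value at $0$ of the analytic function $\sum_{n\ge 0}\widehat f(n)z^n$ in the unit disk. Put $\chi(z)=z$ and $\mathbf 1(z)=1$. For an inner function $\theta$ (that is, $\theta\in H^\infty$ and $|\theta|=1$ a.e. on $\mathbb T$) let $\mathcal K_\theta=H^2\ominus\theta H^2$, let $P_{\mathcal K_\theta}$ be the orthogonal projection onto $\mathcal K_\theta$, and let $S_\theta f=P_{\mathcal K_\theta}(\chi f)$ for $f\in\mathcal K_\theta$. If $\theta(0)=0$, then $\mathbf 1\in\mathcal K_\theta$, and for $c\in\mathbb T$ put $U_{(\theta)c}=S_\theta+c\,(\cdot,\overline\chi\theta)\mathbf 1$, an operator on $\mathcal K_\theta$. Theorem. Let $\theta,\omega\in H^\infty$ be inner functions with $\theta(0)=0$ and $\omega(0)=0$, and let $g\in H^2$ be a multiplier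 between $\mathcal K_\theta$ and $\mathcal K_\omega$, that is, $gf\in\mathcal K_\omega$ for every $f\in\mathcal K_\theta$. Then there is a unique $g_1\in H^2$ such that $g=\omega\,\overline\theta\,\overline{g_1}$ a.e. on $\mathbb T$, and $Xf=gf$ ($f\in\mathcal K_\theta$) defines a bounded linear operator $X:\mathcal K_\theta\to\mathcal K_\omega$. Suppose that $g_1(0)\neq 0$, let $c\in\mathbb T$, and put $$u=\omega+\frac{1}{\overline{g_1(0)}}\,(c-\theta)\,g .$$ Then $u\in\mathcal K_\omega$, and the operator $T=S_\omega+(\cdot,\overline\chi\omega)u$ on $\mathcal K_\omega$ satisfies $$X\,U_{(\theta)c}=T\,X .$$ -/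

import Mathlib

open MeasureTheory AddCircle
open scoped ENNReal ComplexConjugate InnerProductSpace

noncomputable section

namespace ModelSpaces

/-- The circle `ℝ / 2πℤ` has positive length. -/
instance factTwoPiPos : Fact (0 < 2 * Real.pi) := ⟨Real.two_pi_pos⟩

/-- The unit circle, parametrised by the angle: the point `t` stands for `ζ = e ^ (i t)`. -/
abbrev Torus : Type := AddCircle (2 * Real.pi)

/-- The normalized Lebesgue measure `m` on the unit circle. -/
abbrev m : Measure Torus := haarAddCircle

/-- `L²(𝕋, m)`. -/
abbrev L2 : Type := Lp ℂ 2 m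

/-- `L^∞(𝕋, m)`. -/
abbrev LInf : Type := Lp ℂ ∞ m

/-- The function `χ ^ n` on the circle (`χ(ζ) = ζ`), as an element of `L²`. In particular
`chiPow 0` is the constant function `𝟏`. -/
abbrev chiPow (n : ℤ) : L2 := fourierLp 2 n

/-- The identity function `χ(ζ) = ζ` on the circle, as an element of `L^∞`. -/
abbrev chi : LInf := fourierLp ∞ 1

/-- The bounded operator `f ↦ φ f` on `L²`, for `φ ∈ L^∞`. -/
def mulOp (φ : LInf) : L2 →L[ℂ] L2 :=
  (ContinuousLinearMap.mul ℂ ℂ).holderL m ∞ 2 2 φ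

theorem coeFn_mulOp (φ : LInf) (f : L2) : mulOp φ f =ᵐ[m] fun t => φ t * f t := by
  simpa [mulOp] using (ContinuousLinearMap.mul ℂ ℂ).coeFn_holder (r := 2) φ f

/-- The value at the point `z` of the open unit disk of the analytic function
`∑ₙ f̂(n) zⁿ` whose boundary function is `f`. -/
def discValue (f : Torus → ℂ) (z : ℂ) : ℂ := ∑' n : ℕ, fourierCoeff f n * z ^ n

theorem discValue_zero (f : Torus → ℂ) : discValue f 0 = fourierCoeff f 0 := by
  rw [discValue, tsum_eq_single 0]
  · simp
  · intro n hn
    simp [hn]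

theorem fourierCoeff_eq_inner (f : L2) (n : ℤ) : fourierCoeff f n = ⟪chiPow n, f⟫_ℂ := by
  rw [← fourierBasis_repr, HilbertBasis.repr_apply_apply, coe_fourierBasis]

/-- The Hardy space `H²`, as the space of boundary functions on the circle: the functions of `L²`
whose Fourier coefficients of negative index vanish. -/
def H2 : Submodule ℂ L2 where
  carrier := {f | ∀ n : ℤ, n < 0 → fourierCoeff f n = 0}
  add_mem' := by
    intro f g hf hg n hn
    have h1 := hf n hn
    have h2 := hg n hn
    rw [fourierCoeff_eq_inner] at *
    rw [inner_add_right, h1, h2, add_zero]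
  zero_mem' := by
    intro n _
    rw [fourierCoeff_eq_inner, inner_zero_right]
  smul_mem' := by
    intro a f hf n hn
    have h1 := hf n hn
    rw [fourierCoeff_eq_inner] at *
    rw [inner_smul_right, h1, mul_zero]

theorem mem_H2 {f : L2} : f ∈ H2 ↔ ∀ n : ℤ, n < 0 → fourierCoeff f n = 0 := Iff.rfl

/-- An inner function, through its boundary function `θ ∈ L^∞`: it belongs to `H^∞`, that is, its
Fourier coefficients of negative index vanish, and `|θ| = 1` a.e. on the circle. -/
structure IsInner (θ : LInf) : Prop where
  fourierCoeff_eq_zero : ∀ n : ℤ, n < 0 → fourierCoeff θ n = 0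
  norm_eq_one : ∀ᵐ t ∂m, ‖θ t‖ = 1

/-- The model space `K_θ = H² ⊖ θ H²`. -/
def modelSpace (θ : LInf) : Submodule ℂ L2 :=
  H2 ⊓ (H2.map (mulOp θ).toLinearMap)ᗮ

theorem isClosed_H2 : IsClosed (H2 : Set L2) := by
  have h : (H2 : Set L2) = ⋂ (n : ℤ) (_ : n < 0), {f : L2 | ⟪chiPow n, f⟫_ℂ = 0} := by
    ext f
    simp [mem_H2, fourierCoeff_eq_inner]
  rw [h]
  refine isClosed_iInter fun n => isClosed_iInter fun _ => ?_
  exact isClosed_eq (continuous_const.inner continuous_id) continuous_const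

theorem isClosed_modelSpace (θ : LInf) : IsClosed (modelSpace θ : Set L2) :=
  isClosed_H2.inter (Submodule.isClosed_orthogonal _)

instance completeSpace_modelSpace (θ : LInf) : CompleteSpace (modelSpace θ) :=
  (isClosed_modelSpace θ).completeSpace_coe

theorem one_mem_H2 : chiPow 0 ∈ H2 := by
  intro n hn
  rw [fourierCoeff_eq_inner, orthonormal_iff_ite.mp orthonormal_fourier, if_neg hn.ne]

/-- The mean of `θ h` is the product of the means, for `θ ∈ H^∞` and `h ∈ H²`. -/
theorem inner_one_mulOp {θ : LInf} (hθ : ∀ n : ℤ, n < 0 → fourierCoeff θ n = 0) {h : L2}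
    (hh : h ∈ H2) :
    ⟪chiPow 0, mulOp θ h⟫_ℂ = fourierCoeff θ 0 * fourierCoeff h 0 := by
  have h1 : ∀ n : ℤ, ⟪chiPow 0, mulOp θ (chiPow n)⟫_ℂ = fourierCoeff θ (-n) := by
    intro n
    rw [← fourierCoeff_eq_inner]
    refine integral_congr_ae ?_
    filter_upwards [coeFn_mulOp θ (chiPow n), coeFn_fourierLp 2 n] with t h2 h3
    rw [h2, h3, neg_neg, neg_zero, fourier_zero, one_smul, smul_eq_mul, mul_comm]
  have h4 := (hasSum_fourier_series_L2 h).mapL (innerSL ℂ (chiPow 0) ∘L mulOp θ)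
  have h5 := h4.unique (hasSum_single 0 ?_)
  · simp only [ContinuousLinearMap.comp_apply, innerSL_apply_apply, map_smul, h1,
      smul_eq_mul] at h5
    rw [h5, neg_zero]
    exact mul_comm _ _
  · intro n hn
    simp only [ContinuousLinearMap.comp_apply, innerSL_apply_apply, map_smul, h1,
      smul_eq_mul]
    rcases lt_or_gt_of_ne hn with hn | hn
    · rw [hh n hn, zero_mul]
    · rw [hθ (-n) (by omega), mul_zero]

/-- The constant function `𝟏` belongs to `K_θ` when `θ(0) = 0`. -/
theorem one_mem_modelSpace {θ : LInf} (hθ : IsInner θ) (h0 : discValue θ 0 = 0) :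
    chiPow 0 ∈ modelSpace θ := by
  refine ⟨one_mem_H2, ?_⟩
  refine (Submodule.mem_orthogonal' _ _).mpr ?_
  rintro _ ⟨h, hh, rfl⟩
  rw [discValue_zero] at h0
  exact (inner_one_mulOp hθ.fourierCoeff_eq_zero hh).trans (by rw [h0, zero_mul])

/-- The constant function `𝟏` as an element of `K_θ`. -/
def oneK {θ : LInf} (hθ : IsInner θ) (h0 : discValue θ 0 = 0) : modelSpace θ :=
  ⟨chiPow 0, one_mem_modelSpace hθ h0⟩

/-- The function `χ̄ θ`. -/
def chiBarMul (θ : LInf) : L2 := mulOp θ (chiPow (-1))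

/-- The compressed shift `S_θ = P_{K_θ} S |_{K_θ}`. -/
def compressedShift (θ : LInf) : modelSpace θ →L[ℂ] modelSpace θ :=
  (modelSpace θ).orthogonalProjectionOnto ∘L mulOp chi ∘L (modelSpace θ).subtypeL

/-- The one dimensional perturbation `S_θ + (·, χ̄ θ) u` of the compressed shift. The scalar product
`(f, χ̄ θ)`, linear in `f`, is `⟪χ̄ θ, f⟫_ℂ` in Mathlib's convention. -/
def perturbedShift (θ : LInf) (u : modelSpace θ) : modelSpace θ →L[ℂ] modelSpace θ :=
  compressedShift θ +
    (innerSL ℂ (chiBarMul θ) ∘L (modelSpace θ).subtypeL).smulRight u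

/-- The Clark unitary operator `U_{(θ)c} = S_θ + c (·, χ̄ θ) 𝟏`. -/
def clarkOp {θ : LInf} (hθ : IsInner θ) (h0 : discValue θ 0 = 0) (c : ℂ) :
    modelSpace θ →L[ℂ] modelSpace θ :=
  perturbedShift θ (c • oneK hθ h0)

/-- `g ∈ H²` is a multiplier between `K_θ` and `K_ω`: `g f ∈ K_ω` for every `f ∈ K_θ`. -/
def IsMultiplier (θ ω : LInf) (g : L2) : Prop :=
  g ∈ H2 ∧ ∀ f ∈ modelSpace θ, ∃ h ∈ modelSpace ω, h =ᵐ[m] fun t => g t * f t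

end ModelSpaces

end

open MeasureTheory AddCircle Filter
open scoped ENNReal ComplexConjugate InnerProductSpace Topology

noncomputable section

namespace ModelSpaces

/-! Since `S_θ f = χ f - (f, χ̄ θ) θ` (`coe_compressedShift`), the Clark operator is `f ↦ χ f + (f,
χ̄ θ)(c - θ)`, and likewise `T h = χ h + (h, χ̄ ω)(u - ω)`. Multiplication by `g` commutes with `χ`,
so intertwining only requires `(f, χ̄ θ)(c - θ) g = (g f, χ̄ ω)(u - ω)`. From `g = ω θ̄ ḡ₁` one gets
`(g f, χ̄ ω) = (χ f, θ g₁)`. As `χ f` is orthogonal to `θ χ H²`, only `g₁(0)` contributes: the value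
is `conj (g₁(0)) (f, χ̄ θ)` (`inner_chiBarMul_multiplier`). This dictates the formula for `u`; its
coefficient also makes `u` orthogonal to `ω H²` (`perturbation_mem_modelSpace`). -/

/-! ### Pairings and multiplication on `L²` and `H²`. -/

theorem inner_congr_ae {a b a' b' : L2}
    (h : ∀ᵐ t ∂m, conj (a t) * b t = conj (a' t) * b' t) : ⟪a, b⟫_ℂ = ⟪a', b'⟫_ℂ := by
  rw [L2.inner_def, L2.inner_def]
  refine integral_congr_ae ?_
  filter_upwards [h] with t ht
  rw [RCLike.inner_apply, RCLike.inner_apply, mul_comm, ht, mul_comm]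

theorem conj_mul_self_of_norm_eq_one {z : ℂ} (hz : ‖z‖ = 1) : conj z * z = 1 := by
  rw [Complex.conj_mul', hz]
  simp

theorem conj_fourier_mul_fourier (n : ℤ) (t : Torus) :
    conj (fourier n t) * fourier n t = 1 := by
  rw [← fourier_neg, ← fourier_add, neg_add_cancel, fourier_zero]

theorem eq_zero_of_inner_chiPow {f : L2} (h : ∀ n, ⟪chiPow n, f⟫_ℂ = 0) : f = 0 := by
  refine (hasSum_fourier_series_L2 f).unique ?_
  simp only [fourierCoeff_eq_inner, h, zero_smul]
  exact hasSum_zero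

theorem chiPow_mem_H2 {n : ℤ} (hn : 0 ≤ n) : chiPow n ∈ H2 := by
  intro k hk
  rw [fourierCoeff_eq_inner, orthonormal_iff_ite.mp orthonormal_fourier, if_neg (by omega)]

theorem mulOp_chi_chiPow (n : ℤ) : mulOp chi (chiPow n) = chiPow (n + 1) := by
  refine Lp.ext ?_
  filter_upwards [coeFn_mulOp chi (chiPow n), coeFn_fourierLp (T := 2 * Real.pi) ∞ 1,
    coeFn_fourierLp (T := 2 * Real.pi) 2 n,
    coeFn_fourierLp (T := 2 * Real.pi) 2 (n + 1)] with t h1 h2 h3 h4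
  rw [h1, h2, h3, h4, fourier_add, mul_comm]

theorem mulOp_comm (φ ψ : LInf) (f : L2) : mulOp φ (mulOp ψ f) = mulOp ψ (mulOp φ f) := by
  refine Lp.ext ?_
  filter_upwards [coeFn_mulOp φ (mulOp ψ f), coeFn_mulOp ψ (mulOp φ f), coeFn_mulOp φ f,
    coeFn_mulOp ψ f] with t h1 h2 h3 h4
  rw [h1, h2, h3, h4, mul_left_comm]

theorem inner_mulOp_mulOp {φ : LInf} (hφ : ∀ᵐ t ∂m, ‖φ t‖ = 1) (a b : L2) :
    ⟪mulOp φ a, mulOp φ b⟫_ℂ = ⟪a, b⟫_ℂ := by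
  refine inner_congr_ae ?_
  filter_upwards [hφ, coeFn_mulOp φ a, coeFn_mulOp φ b] with t h h1 h2
  rw [h1, h2, map_mul]
  linear_combination (conj (a t) * b t) * conj_mul_self_of_norm_eq_one h

theorem norm_chi : ∀ᵐ t ∂m, ‖chi t‖ = 1 := by
  filter_upwards [coeFn_fourierLp (T := 2 * Real.pi) ∞ 1] with t h
  rw [h]
  exact Circle.norm_coe _

/-- If `a` is orthogonal to `χ ^ n` for all `n > 0`, its pairing with `h ∈ H²` only sees `h(0)`. -/
theorem inner_eq_of_mem_H2 {a h : L2} (hh : h ∈ H2) (ha : ∀ n : ℤ, 0 < n → ⟪a, chiPow n⟫_ℂ = 0) :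
    ⟪a, h⟫_ℂ = fourierCoeff h 0 * ⟪a, chiPow 0⟫_ℂ := by
  have h4 := (hasSum_fourier_series_L2 h).mapL (innerSL ℂ a)
  have h5 := h4.unique (hasSum_single 0 ?_)
  · simpa only [innerSL_apply_apply, map_smul, smul_eq_mul] using h5
  · intro n hn
    simp only [innerSL_apply_apply, map_smul, smul_eq_mul]
    rcases lt_or_gt_of_ne hn with hn | hn
    · rw [hh n hn, zero_mul]
    · rw [ha n hn, mul_zero]

/-- Passing to the adjoint of `A` reduces this to the previous lemma. It lets membership in `H²` and
orthogonality to `θ H²` be tested on monomials. -/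
theorem inner_map_eq_of_mem_H2 (A : L2 →L[ℂ] L2) {a h : L2} (hh : h ∈ H2)
    (ha : ∀ n : ℤ, 0 < n → ⟪a, A (chiPow n)⟫_ℂ = 0) :
    ⟪a, A h⟫_ℂ = fourierCoeff h 0 * ⟪a, A (chiPow 0)⟫_ℂ := by
  have h1 := inner_eq_of_mem_H2 (a := ContinuousLinearMap.adjoint A a) hh
  simp only [ContinuousLinearMap.adjoint_inner_left] at h1
  exact h1 ha

theorem inner_chiPow_mulOp_chiPow (φ : LInf) (n k : ℤ) :
    ⟪chiPow n, mulOp φ (chiPow k)⟫_ℂ = fourierCoeff φ (n - k) := by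
  rw [← fourierCoeff_eq_inner]
  refine integral_congr_ae ?_
  filter_upwards [coeFn_mulOp φ (chiPow k), coeFn_fourierLp 2 k] with t h2 h3
  rw [h2, h3, neg_sub, sub_eq_add_neg, fourier_add, smul_eq_mul, smul_eq_mul]
  ring

theorem mulOp_mem_H2 {φ : LInf} (hφ : ∀ n : ℤ, n < 0 → fourierCoeff φ n = 0) {h : L2}
    (hh : h ∈ H2) : mulOp φ h ∈ H2 := by
  intro n hn
  rw [fourierCoeff_eq_inner, inner_map_eq_of_mem_H2 (mulOp φ) hh, inner_chiPow_mulOp_chiPow,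
    hφ _ (by omega), mul_zero]
  intro k hk
  rw [inner_chiPow_mulOp_chiPow, hφ _ (by omega)]

theorem mulOp_chi_mem_H2 {h : L2} (hh : h ∈ H2) : mulOp chi h ∈ H2 := by
  have key : ∀ n k : ℤ, n < 0 → 0 ≤ k → ⟪chiPow n, mulOp chi (chiPow k)⟫_ℂ = 0 := by
    intro n k hn hk
    rw [mulOp_chi_chiPow, orthonormal_iff_ite.mp orthonormal_fourier, if_neg (by omega)]
  intro n hn
  rw [fourierCoeff_eq_inner, inner_map_eq_of_mem_H2 _ hh fun k hk => key n k hn hk.le,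
    key n 0 hn le_rfl, mul_zero]

/-! ### Model spaces and the compressed shift. -/

theorem mem_modelSpace_iff {θ : LInf} {f : L2} :
    f ∈ modelSpace θ ↔ f ∈ H2 ∧ ∀ n : ℤ, 0 ≤ n → ⟪f, mulOp θ (chiPow n)⟫_ℂ = 0 := by
  refine and_congr_right fun _ => ?_
  refine (Submodule.mem_orthogonal' _ _).trans ⟨fun h n hn => h _ ⟨_, chiPow_mem_H2 hn, rfl⟩, ?_⟩
  rintro h _ ⟨k, hk, rfl⟩
  refine (inner_map_eq_of_mem_H2 (mulOp θ) hk fun n hn => h n hn.le).trans ?_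
  rw [h 0 le_rfl, mul_zero]

theorem mulOp_chiPow_succ (θ : LInf) (n : ℤ) :
    mulOp θ (chiPow (n + 1)) = mulOp chi (mulOp θ (chiPow n)) := by
  rw [mulOp_comm, mulOp_chi_chiPow]

theorem inner_chi_mul_chiPow (θ : LInf) (f : L2) (n : ℤ) :
    ⟪mulOp chi f, mulOp θ (chiPow n)⟫_ℂ = ⟪f, mulOp θ (chiPow (n - 1))⟫_ℂ := by
  rw [← inner_mulOp_mulOp norm_chi f, ← mulOp_chiPow_succ, sub_add_cancel]

/-- For `f ∈ K_θ` and `h ∈ H²`, `(θ h, χ f) = h(0) (χ̄ θ, f)`. -/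
theorem inner_chi_mul_mulOp {θ : LInf} {f h : L2} (hf : f ∈ modelSpace θ) (hh : h ∈ H2) :
    ⟪mulOp chi f, mulOp θ h⟫_ℂ = fourierCoeff h 0 * ⟪f, chiBarMul θ⟫_ℂ := by
  rw [inner_map_eq_of_mem_H2 _ hh, inner_chi_mul_chiPow, zero_sub, chiBarMul]
  intro n hn
  rw [inner_chi_mul_chiPow]
  exact (mem_modelSpace_iff.mp hf).2 _ (by omega)

/-- Dividing by `χ` stays in `H²` because `θ(0) = 0`; unimodularity of `θ` reduces the orthogonality
to that of `χ̄` and `χ ^ n`, `n ≥ 0`. -/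
theorem chiBarMul_mem_modelSpace {θ : LInf} (hθ : IsInner θ) (h0 : discValue θ 0 = 0) :
    chiBarMul θ ∈ modelSpace θ := by
  rw [discValue_zero] at h0
  refine mem_modelSpace_iff.mpr ⟨fun n hn => ?_, fun n hn => ?_⟩
  · rw [fourierCoeff_eq_inner, chiBarMul, inner_chiPow_mulOp_chiPow]
    rcases (show n - -1 ≤ 0 by omega).lt_or_eq with h | h
    · exact hθ.fourierCoeff_eq_zero _ h
    · rw [h, h0]
  · rw [chiBarMul, inner_mulOp_mulOp hθ.norm_eq_one, orthonormal_iff_ite.mp orthonormal_fourier,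
      if_neg (by omega)]

/-- The compressed shift acts by `S_θ f = χ f - (f, χ̄ θ) θ`. -/
theorem coe_compressedShift {θ : LInf} (hθ : IsInner θ) (f : modelSpace θ) :
    (compressedShift θ f : L2) =
      mulOp chi f - ⟪chiBarMul θ, (f : L2)⟫_ℂ • mulOp θ (chiPow 0) := by
  change (modelSpace θ).starProjection (mulOp chi f) = _
  -- The candidate lies in `K_θ`, and it differs from `χ f` by a multiple of `θ`, which is
  -- orthogonal to `K_θ`.
  refine Submodule.eq_starProjection_of_mem_orthogonal (mem_modelSpace_iff.mpr ⟨?_, ?_⟩) ?_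
  · exact H2.sub_mem (mulOp_chi_mem_H2 f.2.1)
      (H2.smul_mem _ (mulOp_mem_H2 hθ.fourierCoeff_eq_zero one_mem_H2))
  · intro n hn
    rw [inner_sub_left, inner_smul_left, inner_conj_symm, inner_mulOp_mulOp hθ.norm_eq_one,
      inner_chi_mul_mulOp f.2 (chiPow_mem_H2 hn), fourierCoeff_eq_inner,
      orthonormal_iff_ite.mp orthonormal_fourier, mul_comm, sub_self]
  · rw [sub_sub_cancel]
    refine (Submodule.mem_orthogonal _ _).mpr fun w hw => ?_
    rw [inner_smul_right, (mem_modelSpace_iff.mp hw).2 0 le_rfl, mul_zero]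

/-! ### The conjugate factor `g₁` and the operator `X`. -/

/-- Unimodularity makes `h ↦ ω θ̄ h̄` an involution, whence both existence and uniqueness of `g₁`.
-/
theorem ae_eq_conj_of_ae_eq {θ ω : LInf} (hθ : IsInner θ) (hω : IsInner ω) {g h : L2}
    (H : g =ᵐ[m] fun t => ω t * conj (θ t) * conj (h t)) :
    h =ᵐ[m] fun t => ω t * conj (θ t) * conj (g t) := by
  filter_upwards [H, hθ.norm_eq_one, hω.norm_eq_one] with t h1 h2 h3
  have h4 := conj_mul_self_of_norm_eq_one h2
  have h5 := conj_mul_self_of_norm_eq_one h3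
  rw [h1]
  simp only [map_mul, Complex.conj_conj]
  linear_combination (-h t) * h4 - h t * (conj (θ t) * θ t) * h5

theorem existsUnique_conj_factor {θ ω : LInf} (hθ : IsInner θ) (hω : IsInner ω)
    (hθ0 : discValue θ 0 = 0) {g : L2} (hg : IsMultiplier θ ω g) :
    ∃! g₁ : L2, g₁ ∈ H2 ∧ g =ᵐ[m] fun t => ω t * conj (θ t) * conj (g₁ t) := by
  have hG : mulOp ω (mulOp (star θ) (star g)) =ᵐ[m] fun t => ω t * conj (θ t) * conj (g t) := by
    filter_upwards [coeFn_mulOp ω (mulOp (star θ) (star g)), coeFn_mulOp (star θ) (star g),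
      Lp.coeFn_star θ, Lp.coeFn_star g] with t h1 h2 h3 h4
    rw [h1, h2, h3, h4, mul_assoc]
    rfl
  refine ⟨mulOp ω (mulOp (star θ) (star g)), ⟨fun n hn => ?_, ?_⟩, ?_⟩
  -- The multiplier is tested on `χ̄ θ`: the coefficient of `g₁` at `n < 0` is the pairing of `g χ̄
  -- θ ∈ K_ω` with `ω χ ^ (-n - 1)`, whose exponent is nonnegative.
  · obtain ⟨h, hh, hhg⟩ := hg.2 _ (chiBarMul_mem_modelSpace hθ hθ0)
    rw [fourierCoeff_eq_inner, ← (mem_modelSpace_iff.mp hh).2 (-n + -1) (by omega)]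
    refine inner_congr_ae ?_
    filter_upwards [hG, hhg, coeFn_fourierLp (T := 2 * Real.pi) 2 n,
      coeFn_fourierLp (T := 2 * Real.pi) 2 (-1), coeFn_fourierLp (T := 2 * Real.pi) 2 (-n + -1),
      coeFn_mulOp ω (chiPow (-n + -1)), coeFn_mulOp θ (chiPow (-1))] with t h1 h2 h3 h4 h5 h6 h7
    rw [h1, h2, h3, h6, h5, chiBarMul, h7, h4, fourier_add, fourier_neg (n := n)]
    simp only [map_mul]
    linear_combination (-conj (fourier n t) * ω t * conj (θ t) * conj (g t)) *
      conj_fourier_mul_fourier (-1) t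
  · exact ae_eq_conj_of_ae_eq hθ hω hG
  · rintro h ⟨-, hh⟩
    exact Lp.ext ((ae_eq_conj_of_ae_eq hθ hω hh).trans hG.symm)

/-- Boundedness comes from the closed graph theorem: each Fourier coefficient of `g f` is the
pairing of `f` with the fixed `L²` function `χ ^ n ḡ`, hence continuous in `f`, and the coefficients
determine the limit. -/
theorem exists_multiplierOp {θ ω : LInf} {g : L2} (hg : IsMultiplier θ ω g) :
    ∃ X : modelSpace θ →L[ℂ] modelSpace ω,
      ∀ f : modelSpace θ, (X f : L2) =ᵐ[m] fun t => g t * (f : L2) t := by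
  choose F hF hFg using fun f : modelSpace θ => hg.2 f f.2
  let X : modelSpace θ →ₗ[ℂ] modelSpace ω :=
    { toFun := fun f => ⟨F f, hF f⟩
      map_add' := by
        intro a b
        refine Subtype.ext (Lp.ext ?_)
        filter_upwards [hFg (a + b), hFg a, hFg b, Lp.coeFn_add (F a) (F b),
          Lp.coeFn_add (a : L2) (b : L2)] with t h1 h2 h3 h4 h5
        refine h1.trans (Eq.trans ?_ h4.symm)
        rw [Submodule.coe_add, h5, Pi.add_apply, Pi.add_apply, h2, h3, mul_add]
      map_smul' := by
        intro c a
        refine Subtype.ext (Lp.ext ?_)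
        filter_upwards [hFg (c • a), hFg a, Lp.coeFn_smul c (F a),
          Lp.coeFn_smul c (a : L2)] with t h1 h2 h3 h4
        refine h1.trans (Eq.trans ?_ h3.symm)
        rw [Submodule.coe_smul, h4, Pi.smul_apply, Pi.smul_apply, h2, smul_eq_mul, smul_eq_mul,
          mul_left_comm] }
  have hX : ∀ n (f : modelSpace θ),
      ⟪chiPow n, (X f : L2)⟫_ℂ = ⟪mulOp (fourierLp ∞ n) (star g), (f : L2)⟫_ℂ := by
    intro n f
    refine inner_congr_ae ?_
    filter_upwards [hFg f, coeFn_fourierLp (T := 2 * Real.pi) 2 n,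
      coeFn_fourierLp (T := 2 * Real.pi) ∞ n, coeFn_mulOp (fourierLp ∞ n) (star g),
      Lp.coeFn_star g] with t h1 h2 h3 h4 h5
    rw [h2, h4, h3, h5, map_mul, Pi.star_apply]
    change _ * F f t = _ * conj (conj (g t)) * _
    rw [h1, Complex.conj_conj, mul_assoc]
  refine ⟨⟨X, X.continuous_of_seq_closed_graph fun u x y hu hXu => ?_⟩, hFg⟩
  refine Subtype.ext (sub_eq_zero.mp (eq_zero_of_inner_chiPow fun n => ?_))
  rw [inner_sub_right, sub_eq_zero, hX]
  have h1 : Tendsto (fun k => ⟪chiPow n, (X (u k) : L2)⟫_ℂ) atTop (𝓝 ⟪chiPow n, (y : L2)⟫_ℂ) :=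
    tendsto_const_nhds.inner ((continuous_subtype_val.tendsto y).comp hXu)
  simp only [hX] at h1
  exact tendsto_nhds_unique h1
    (tendsto_const_nhds.inner ((continuous_subtype_val.tendsto x).comp hu))

/-! ### The perturbation vector and the intertwining relation. -/

/-- `(g f, χ̄ ω) = conj (g₁(0)) (f, χ̄ θ)` when `g = ω θ̄ ḡ₁`. -/
theorem inner_chiBarMul_multiplier {θ ω : LInf} (hω : IsInner ω) {g g₁ f h : L2}
    (hf : f ∈ modelSpace θ) (hg₁ : g₁ ∈ H2)
    (hg : g =ᵐ[m] fun t => ω t * conj (θ t) * conj (g₁ t)) (hh : h =ᵐ[m] fun t => g t * f t) :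
    ⟪chiBarMul ω, h⟫_ℂ = conj (fourierCoeff g₁ 0) * ⟪chiBarMul θ, f⟫_ℂ := by
  -- The right side becomes `(χ f, θ g₁)`; the integrands then agree because `ω̄ ω = 1`.
  rw [← inner_conj_symm (chiBarMul θ), ← map_mul, ← inner_chi_mul_mulOp hf hg₁, inner_conj_symm]
  refine inner_congr_ae ?_
  filter_upwards [hg, hh, hω.norm_eq_one, coeFn_mulOp ω (chiPow (-1)),
    coeFn_fourierLp (T := 2 * Real.pi) 2 (-1), coeFn_fourierLp (T := 2 * Real.pi) ∞ 1,
    coeFn_mulOp θ g₁, coeFn_mulOp chi f] with t h1 h2 h3 h4 h5 h6 h7 h8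
  rw [chiBarMul, h4, h5, h7, h8, h6, h2, h1, fourier_neg]
  simp only [map_mul, Complex.conj_conj]
  linear_combination (fourier 1 t * conj (θ t) * conj (g₁ t) * f t) *
    conj_mul_self_of_norm_eq_one h3

theorem perturbation_mem_modelSpace {θ ω : LInf} (hθ : IsInner θ) (hω : IsInner ω)
    (hθ0 : discValue θ 0 = 0) {g g₁ : L2} (hg : IsMultiplier θ ω g) (hg₁ : g₁ ∈ H2)
    (hgg : g =ᵐ[m] fun t => ω t * conj (θ t) * conj (g₁ t)) (h0 : fourierCoeff g₁ 0 ≠ 0) (c : ℂ) :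
    mulOp ω (chiPow 0) + (1 / conj (fourierCoeff g₁ 0)) • (c • g - mulOp θ g) ∈
      modelSpace ω := by
  -- This is the multiplier property applied to `𝟏 ∈ K_θ`.
  have hgω : g ∈ modelSpace ω := by
    obtain ⟨h, hh, hhg⟩ := hg.2 _ (one_mem_modelSpace hθ hθ0)
    have : h = g := by
      refine Lp.ext ?_
      filter_upwards [hhg, coeFn_fourierLp (T := 2 * Real.pi) 2 0] with t h1 h2
      rw [h1, h2, fourier_zero, mul_one]
    exact this ▸ hh
  refine mem_modelSpace_iff.mpr ⟨?_, fun n hn => ?_⟩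
  · exact H2.add_mem (mulOp_mem_H2 hω.fourierCoeff_eq_zero one_mem_H2) (H2.smul_mem _
      (H2.sub_mem (H2.smul_mem _ hg.1) (mulOp_mem_H2 hθ.fourierCoeff_eq_zero hg.1)))
  -- Here `θ g = ω ḡ₁`, so `ω` cancels from the pairing.
  · have h1 : ⟪mulOp θ g, mulOp ω (chiPow n)⟫_ℂ = fourierCoeff g₁ (-n) := by
      rw [fourierCoeff_eq_inner]
      refine inner_congr_ae ?_
      filter_upwards [ae_eq_conj_of_ae_eq hθ hω hgg, coeFn_mulOp θ g, coeFn_mulOp ω (chiPow n),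
        coeFn_fourierLp (T := 2 * Real.pi) 2 n,
        coeFn_fourierLp (T := 2 * Real.pi) 2 (-n)] with t h1 h2 h3 h4 h5
      rw [h1, h2, h3, h4, h5, fourier_neg, map_mul, Complex.conj_conj]
      ring
    rw [inner_add_left, inner_smul_left, inner_sub_left, inner_smul_left, h1,
      (mem_modelSpace_iff.mp hgω).2 n hn, inner_mulOp_mulOp hω.norm_eq_one,
      orthonormal_iff_ite.mp orthonormal_fourier]
    -- At `n = 0` the normalized term `g₁(0) / g₁(0)` cancels the `1` contributed by `ω`; for `n >
    -- 0` both contributions vanish.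
    rcases hn.eq_or_lt with rfl | hn
    · rw [if_pos rfl, neg_zero, map_div₀, map_one, Complex.conj_conj]
      field_simp
      ring
    · rw [if_neg hn.ne, hg₁ (-n) (by omega)]
      simp

theorem coe_perturbedShift {θ : LInf} (hθ : IsInner θ) (u f : modelSpace θ) :
    (perturbedShift θ u f : L2) = mulOp chi f - ⟪chiBarMul θ, (f : L2)⟫_ℂ • mulOp θ (chiPow 0) +
      ⟪chiBarMul θ, (f : L2)⟫_ℂ • (u : L2) := by
  rw [← coe_compressedShift hθ]
  rfl

theorem multiplierOp_comp_clarkOp {θ ω : LInf} (hθ : IsInner θ) (hω : IsInner ω)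
    (hθ0 : discValue θ 0 = 0) {g g₁ : L2} (hg₁ : g₁ ∈ H2)
    (hgg : g =ᵐ[m] fun t => ω t * conj (θ t) * conj (g₁ t)) (h0 : fourierCoeff g₁ 0 ≠ 0) (c : ℂ)
    {X : modelSpace θ →L[ℂ] modelSpace ω}
    (hX : ∀ f : modelSpace θ, (X f : L2) =ᵐ[m] fun t => g t * (f : L2) t) {u : modelSpace ω}
    (hu : (u : L2) =
      mulOp ω (chiPow 0) + (1 / conj (fourierCoeff g₁ 0)) • (c • g - mulOp θ g)) :
    X ∘L clarkOp hθ hθ0 c = perturbedShift ω u ∘L X := by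
  have hc : conj (fourierCoeff g₁ 0) ≠ 0 := (map_ne_zero _).mpr h0
  refine ContinuousLinearMap.ext fun f => Subtype.ext ?_
  set a : ℂ := ⟪chiBarMul θ, (f : L2)⟫_ℂ with ha
  -- The `ω` in `u` absorbs the `-ω` of `S_ω`, and the factor `conj (g₁(0))` of the pairing cancels
  -- the denominator in `u`.
  have hT : (perturbedShift ω u (X f) : L2) =
      mulOp chi (X f : L2) + a • (c • g - mulOp θ g) := by
    rw [coe_perturbedShift hω, inner_chiBarMul_multiplier hω f.2 hg₁ hgg (hX f), hu, ← ha,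
      smul_add, smul_smul, mul_one_div, mul_div_cancel_left₀ _ hc]
    abel
  have hU : (clarkOp hθ hθ0 c f : L2) =
      mulOp chi (f : L2) + a • (c • chiPow 0 - mulOp θ (chiPow 0)) := by
    rw [clarkOp, coe_perturbedShift hθ, ← ha, smul_sub]
    change _ + a • (c • chiPow 0) = _
    abel
  change (X (clarkOp hθ hθ0 c f) : L2) = perturbedShift ω u (X f)
  rw [hT]
  refine Lp.ext ?_
  have hXU := hX (clarkOp hθ hθ0 c f)
  rw [hU] at hXU
  filter_upwards [hXU, hX f, coeFn_mulOp chi (f : L2), coeFn_mulOp chi (X f : L2),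
    Lp.coeFn_add (mulOp chi (f : L2)) (a • (c • chiPow 0 - mulOp θ (chiPow 0))),
    Lp.coeFn_add (mulOp chi (X f : L2)) (a • (c • g - mulOp θ g)),
    Lp.coeFn_smul a (c • chiPow 0 - mulOp θ (chiPow 0)), Lp.coeFn_smul a (c • g - mulOp θ g),
    Lp.coeFn_sub (c • chiPow 0) (mulOp θ (chiPow 0)), Lp.coeFn_sub (c • g) (mulOp θ g),
    Lp.coeFn_smul c (chiPow 0), Lp.coeFn_smul c g, coeFn_mulOp θ (chiPow 0), coeFn_mulOp θ g,
    coeFn_fourierLp (T := 2 * Real.pi) 2 0]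
    with t h1 h2 h3 h4 h5 h6 h7 h8 h9 h10 h11 h12 h13 h14 h15
  rw [h1, h5, h6]
  simp only [Pi.add_apply]
  rw [h7, h8, h3, h4]
  simp only [Pi.smul_apply]
  rw [h9, h10]
  simp only [Pi.sub_apply]
  rw [h11, h12, h13, h14]
  simp only [Pi.smul_apply]
  rw [h15, fourier_zero, h2]
  simp only [smul_eq_mul]
  ring

theorem coeFn_perturbation (θ ω : LInf) (g : L2) (k c : ℂ) :
    (mulOp ω (chiPow 0) + k • (c • g - mulOp θ g) : L2) =ᵐ[m]
      fun t => ω t + k * (c - θ t) * g t := by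
  filter_upwards [Lp.coeFn_add (mulOp ω (chiPow 0)) (k • (c • g - mulOp θ g)),
    Lp.coeFn_smul k (c • g - mulOp θ g), Lp.coeFn_sub (c • g) (mulOp θ g), Lp.coeFn_smul c g,
    coeFn_mulOp θ g, coeFn_mulOp ω (chiPow 0), coeFn_fourierLp (T := 2 * Real.pi) 2 0]
    with t h1 h2 h3 h4 h5 h6 h7
  rw [h1, Pi.add_apply, h2, Pi.smul_apply, h3, Pi.sub_apply, h4, h5, h6, h7, fourier_zero,
    Pi.smul_apply, smul_eq_mul, smul_eq_mul]
  ring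

end ModelSpaces

end

theorem theorem3p4 (θ ω : ModelSpaces.LInf)
    (hθ : ModelSpaces.IsInner θ) (hω : ModelSpaces.IsInner ω)
    (hθ0 : ModelSpaces.discValue θ 0 = 0) (hω0 : ModelSpaces.discValue ω 0 = 0)
    (g : ModelSpaces.L2) (hg : ModelSpaces.IsMultiplier θ ω g) :
    (∃! g₁ : ModelSpaces.L2, g₁ ∈ ModelSpaces.H2 ∧
      g =ᵐ[ModelSpaces.m] fun t => ω t * conj (θ t) * conj (g₁ t)) ∧
    ∃ X : ModelSpaces.modelSpace θ →L[ℂ] ModelSpaces.modelSpace ω,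
      (∀ f : ModelSpaces.modelSpace θ,
        (X f : ModelSpaces.L2) =ᵐ[ModelSpaces.m] fun t => g t * (f : ModelSpaces.L2) t) ∧
      ∀ g₁ ∈ ModelSpaces.H2,
        (g =ᵐ[ModelSpaces.m] fun t => ω t * conj (θ t) * conj (g₁ t)) →
        ModelSpaces.discValue g₁ 0 ≠ 0 →
        ∀ c : ℂ, ‖c‖ = 1 →
          ∃ u : ModelSpaces.modelSpace ω,
            ((u : ModelSpaces.L2) =ᵐ[ModelSpaces.m]
              fun t => ω t + 1 / conj (ModelSpaces.discValue g₁ 0) * (c - θ t) * g t) ∧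
            X ∘L ModelSpaces.clarkOp hθ hθ0 c = ModelSpaces.perturbedShift ω u ∘L X := by
  refine ⟨ModelSpaces.existsUnique_conj_factor hθ hω hθ0 hg, ?_⟩
  obtain ⟨X, hX⟩ := ModelSpaces.exists_multiplierOp hg
  refine ⟨X, hX, fun g₁ hg₁ hgg h0 c _ => ?_⟩
  rw [ModelSpaces.discValue_zero] at h0 ⊢
  refine ⟨⟨_, ModelSpaces.perturbation_mem_modelSpace hθ hω hθ0 hg hg₁ hgg h0 c⟩,
    ModelSpaces.coeFn_perturbation θ ω g _ c, ?_⟩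
  exact ModelSpaces.multiplierOp_comp_clarkOp hθ hω hθ0 hg₁ hgg h0 c hX rfl
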